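/- All graphs are finite and simple. The chromatic symmetric function of a graph $G$ with vertex set $V$ is the formal power series $\mathbf X_G=\sum_\kappa\prod_{v\in V}x_{\kappa(v)}$ in countably many commuting indeterminates $x_1,x_2,\dots$, where the sum runs over all proper colorings $\kappa$ of $G$ by positive integers, that is, over all maps $\kappa:V\to\{1,2,3,\dots\}$ with $\kappa(v)\ne\kappa(w)$ whenever $v$ and $w$ are adjacent. A leaf is a vertex of degree $1$. A crab is a connected graph that contains exactly one cycle and in which every vertex not on the cycle is a leaf. Proposition. Let $G$ and $H$ be crabs such that, in each of the two graphs, the degrees of the non-leaf vertices are pairwise distinct and all greater than $2$. If $\mathbf X_G=\mathbf X_H$, then $G$ and $H$ are isomorphic. -/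

import Mathlib

namespace SimpleGraph

section ChromaticSymmetricFunction

variable {V : Type*} [Fintype V] (G : SimpleGraph V)

/-- The exponent vector of the monomial `∏ v, x_{κ v}` attached to a proper coloring `κ` of `G`
with colors in the positive integers. -/
noncomputable def coloringExponent (κ : G.Coloring ℕ+) : ℕ+ →₀ ℕ :=
  ∑ v : V, Finsupp.single (κ v) 1

/-- Only finitely many proper colorings contribute to a given monomial. -/
theorem finite_coloringExponent_eq (d : ℕ+ →₀ ℕ) :
    {κ : G.Coloring ℕ+ | G.coloringExponent κ = d}.Finite := by
  classical
  have hfin : (Set.univ.pi fun _ : V => (d.support : Set ℕ+)).Finite :=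
    Set.Finite.pi fun _ => d.support.finite_toSet
  refine Set.Finite.of_finite_image (f := fun κ : G.Coloring ℕ+ => (κ : V → ℕ+))
    (hfin.subset ?_) (fun κ _ κ' _ h => DFunLike.coe_injective h)
  rintro _ ⟨κ, hκ, rfl⟩ v -
  have hκ' : G.coloringExponent κ = d := hκ
  have h1 : 1 ≤ d (κ v) := by
    rw [← hκ', coloringExponent, Finsupp.finsetSum_apply]
    calc 1 = (Finsupp.single (κ v) 1 : ℕ+ →₀ ℕ) (κ v) := by simp
      _ ≤ _ := Finset.single_le_sum
        (f := fun w : V => (Finsupp.single (κ w) 1 : ℕ+ →₀ ℕ) (κ v))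
        (fun _ _ => Nat.zero_le _) (Finset.mem_univ v)
  simp only [Finset.mem_coe, Finsupp.mem_support_iff]
  omega

/-- The chromatic symmetric function `∑ κ, ∏ v, x_{κ v}`, the sum over all proper colorings `κ` of
`G` by positive integers, as a formal power series in `x₁, x₂, …`: the coefficient of a monomial is
the (finite) number of proper colorings that contribute to it. -/
noncomputable def chromaticSymmetricFunction : MvPowerSeries ℕ+ ℚ :=
  fun d => ((G.finite_coloringExponent_eq d).toFinset.card : ℚ)

open scoped MvPowerSeries.WithPiTopology in
/-- The chromatic symmetric function is the sum of the series `∑ κ, ∏ v, x_{κ v}`, coefficientwise,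
whichever topology is put on the coefficients. -/
theorem hasSum_chromaticSymmetricFunction [TopologicalSpace ℚ] :
    HasSum (fun κ : G.Coloring ℕ+ => ∏ v : V, (MvPowerSeries.X (κ v) : MvPowerSeries ℕ+ ℚ))
      G.chromaticSymmetricFunction := by
  classical
  refine Pi.hasSum.2 fun d => ?_
  have hmon : ∀ κ : G.Coloring ℕ+, (∏ v : V, (MvPowerSeries.X (κ v) : MvPowerSeries ℕ+ ℚ)) d =
      if G.coloringExponent κ = d then 1 else 0 := by
    intro κ
    have h : (∏ v : V, (MvPowerSeries.X (κ v) : MvPowerSeries ℕ+ ℚ)) =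
        MvPowerSeries.monomial (G.coloringExponent κ) 1 := by
      simp only [MvPowerSeries.X, coloringExponent, MvPowerSeries.prod_monomial,
        Finset.prod_const_one]
    rw [h]
    refine (MvPowerSeries.coeff_monomial d (G.coloringExponent κ) (1 : ℚ)).trans ?_
    simp only [eq_comm]
  have hval : G.chromaticSymmetricFunction d =
      ∑ κ ∈ (G.finite_coloringExponent_eq d).toFinset,
        (∏ v : V, (MvPowerSeries.X (κ v) : MvPowerSeries ℕ+ ℚ)) d := by
    rw [Finset.sum_congr rfl (g := fun _ => (1 : ℚ))]
    · simp [chromaticSymmetricFunction]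
    · intro κ hκ
      rw [hmon, if_pos (by simpa using hκ)]
  rw [hval]
  refine hasSum_sum_of_ne_finset_zero fun κ hκ => ?_
  rw [hmon, if_neg (by simpa using hκ)]

end ChromaticSymmetricFunction

section Crab

variable {V : Type*} (G : SimpleGraph V)

/-- `C` is a cycle of `G`, seen as a subgraph (so neither the base point nor the direction in which
the cycle is traversed matters). -/
def IsCycleSubgraph (C : G.Subgraph) : Prop :=
  ∃ (v : V) (p : G.Walk v v), p.IsCycle ∧ p.toSubgraph = C

/-- `G` contains exactly one cycle. -/
def IsUnicyclic : Prop :=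
  ∃! C : G.Subgraph, G.IsCycleSubgraph C

/-- A leaf: a vertex of degree `1`. -/
def IsLeaf [Fintype V] [DecidableRel G.Adj] (v : V) : Prop :=
  G.degree v = 1

/-- A crab: a connected unicyclic graph in which every vertex not on the cycle is a leaf. -/
structure IsCrab [Fintype V] [DecidableRel G.Adj] : Prop where
  connected : G.Connected
  unicyclic : G.IsUnicyclic
  isLeaf_of_notMem_cycle :
    ∀ C : G.Subgraph, G.IsCycleSubgraph C → ∀ v : V, v ∉ C.verts → G.IsLeaf v

end Crab

end SimpleGraph

/-! Inclusion–exclusion over the edges violated by a coloring gives `X_G = ∑_A (-1)^|A| p_{λ(A)}`,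
where `A` runs over the sets of edges and `λ(A)` lists the component sizes of `(V, A)`. Products of
power sums are linearly independent, so `X_G` determines every coefficient of this expansion
(`powerSumExpansion_eq`).

Let `r` send each leaf to its neighbor and fix the cycle vertices. The fiber of `r` over a cycle
vertex `u`, its cluster, has `deg u - 1` elements, so the clusters have pairwise distinct sizes, all
at least 2. If `λ(A)` has no part 1, then `A` contains every pendant edge. Among such `A`, only the
set of pendant edges has as many components as there are clusters, and those with one component
fewer are the pendant edges plus one cycle edge `uv`. All sets of a given such type thus have the
same cardinality, so nothing cancels and the coefficient is nonzero.

The types of the first kind give the cluster sizes. One of the second kind comes from the cluster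
sizes by replacing those of `u` and `v` by their sum; the two missing sizes identify `u` and `v`,
because sizes are distinct. So `X_G` determines which cycle vertices are adjacent (`adj_of_adj`) and
how many leaves each carries, hence `G` up to isomorphism. -/

/-! ### Linear independence of products of power sums. -/

section PowerSums

open Finset

/-- The coefficient of the monomial with exponent vector `d` in the product of power sums
`∏ k ∈ m, p_k`: the number of ways to color the parts of `m` so that the parts colored `i` add up
to `d i`. -/
noncomputable def powerSumCoeff (m : Multiset ℕ) (d : ℕ+ →₀ ℕ) : ℕ :=
  Nat.card {f : m.ToType → ℕ+ // ∑ x, Finsupp.single (f x) x.1 = d}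

/-- Lets the parts be indexed by any finite type, such as the components of a graph; repeated values
stay separate in `Multiset.ToType`. -/
theorem card_eq_powerSumCoeff {ι : Type*} [Fintype ι] (s : ι → ℕ) (d : ℕ+ →₀ ℕ) :
    Nat.card {f : ι → ℕ+ // ∑ i, Finsupp.single (f i) (s i) = d} =
      powerSumCoeff ((univ : Finset ι).val.map s) d := by
  classical
  obtain ⟨e, he⟩ : ∃ e : ι ≃ ((univ : Finset ι).val.map s).ToType, ∀ i, (e i).1 = s i := by
    let e₁ : (univ : Finset ι).val.ToType ≃ ι :=
      Equiv.ofBijective (fun x => x.1) <| by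
        constructor
        · rintro ⟨x, k, hk⟩ ⟨y, l, hl⟩ (rfl : x = y)
          have : Multiset.count x (univ : Finset ι).val = 1 :=
            Multiset.count_eq_one_of_mem univ.nodup (mem_univ x)
          have h0 : k = l := by omega
          subst h0
          rfl
        · intro i
          exact ⟨⟨i, ⟨0, by simp⟩⟩, rfl⟩
    refine ⟨e₁.symm.trans (Multiset.mapEquiv _ s), fun i => ?_⟩
    rw [Equiv.trans_apply, Multiset.mapEquiv_apply]
    exact congrArg s (e₁.apply_symm_apply i)
  unfold powerSumCoeff
  refine Nat.card_congr ((e.arrowCongr (Equiv.refl ℕ+)).subtypeEquiv fun f => ?_)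
  rw [← e.sum_comp]
  simp [Equiv.arrowCongr, he]

/-- An exponent vector whose nonzero entries are the parts of `m`. -/
noncomputable def partsExponent (m : Multiset ℕ) : ℕ+ →₀ ℕ :=
  ∑ x : m.ToType, Finsupp.single (Nat.succPNat (Fintype.equivFin m.ToType x)) x.1

theorem succPNat_equivFin_injective (m : Multiset ℕ) :
    Function.Injective fun x : m.ToType => Nat.succPNat (Fintype.equivFin m.ToType x) :=
  fun _ _ h => (Fintype.equivFin m.ToType).injective (Fin.ext (Nat.succPNat_injective h))

theorem partsExponent_apply (m : Multiset ℕ) (x : m.ToType) :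
    partsExponent m (Nat.succPNat (Fintype.equivFin m.ToType x)) = x.1 := by
  classical
  rw [partsExponent, Finsupp.finsetSum_apply, Finset.sum_eq_single x]
  · simp
  · intro y _ hy
    exact Finsupp.single_eq_of_ne fun h => hy (succPNat_equivFin_injective m h.symm)
  · simp

/-- The point is finiteness, as `Nat.card` of an infinite type is 0: a part 0 could take any color,
while a positive part must take a color in the support. -/
theorem powerSumCoeff_partsExponent_self {m : Multiset ℕ} (hm : ∀ k ∈ m, 0 < k) :
    powerSumCoeff m (partsExponent m) ≠ 0 := by
  classical
  unfold powerSumCoeff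
  have hfin : {f : m.ToType → ℕ+ | ∑ x, Finsupp.single (f x) x.1 = partsExponent m}.Finite := by
    refine (Set.Finite.pi fun _ => (partsExponent m).support.finite_toSet).subset
      (s := Set.univ.pi fun _ => ((partsExponent m).support : Set ℕ+)) ?_
    intro f hf x _
    have hf' : ∑ x, Finsupp.single (f x) x.1 = partsExponent m := hf
    have hx : 0 < x.1 := hm _ (Multiset.coe_mem)
    have h1 : x.1 ≤ partsExponent m (f x) := by
      rw [← hf', Finsupp.finsetSum_apply]
      calc x.1 = (Finsupp.single (f x) x.1 : ℕ+ →₀ ℕ) (f x) := by simp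
        _ ≤ _ := Finset.single_le_sum
          (f := fun y : m.ToType => (Finsupp.single (f y) y.1 : ℕ+ →₀ ℕ) (f x))
          (fun _ _ => Nat.zero_le _) (Finset.mem_univ x)
    simp only [Finset.mem_coe, Finsupp.mem_support_iff]
    omega
  have : Finite {f : m.ToType → ℕ+ // ∑ x, Finsupp.single (f x) x.1 = partsExponent m} := hfin
  have : Nonempty {f : m.ToType → ℕ+ // ∑ x, Finsupp.single (f x) x.1 = partsExponent m} :=
    ⟨⟨_, rfl⟩⟩
  exact Nat.card_pos.ne'

/-- The monomial has one color for each part of `m`, and all of them must be used. With at most that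
many parts in `n`, each color is used exactly once, so the parts of `n` are the exponents. -/
theorem eq_of_powerSumCoeff_partsExponent_ne_zero {m n : Multiset ℕ} (hm : ∀ k ∈ m, 0 < k)
    (hle : n.card ≤ m.card) (h : powerSumCoeff n (partsExponent m) ≠ 0) : n = m := by
  classical
  obtain ⟨⟨f, hf⟩⟩ := (Nat.card_ne_zero.1 h).1
  set g : m.ToType → ℕ+ := fun x => Nat.succPNat (Fintype.equivFin m.ToType x) with hg
  have hginj : Function.Injective g := succPNat_equivFin_injective m
  have hsub : univ.image g ⊆ univ.image f := by
    intro i hi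
    obtain ⟨x, -, rfl⟩ := mem_image.1 hi
    by_contra hni
    have h0 : partsExponent m (g x) = 0 := by
      rw [← hf, Finsupp.finsetSum_apply]
      refine Finset.sum_eq_zero fun y _ => Finsupp.single_eq_of_ne fun hy => hni ?_
      exact mem_image.2 ⟨y, mem_univ y, hy.symm⟩
    rw [hg, partsExponent_apply] at h0
    exact (hm _ Multiset.coe_mem).ne' h0
  have hcg : (univ.image g).card = m.card := by
    rw [card_image_of_injective _ hginj, card_univ, Multiset.card_coe]
  have hcf : (univ.image f).card ≤ n.card := card_image_le.trans (by simp)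
  have heq : univ.image g = univ.image f :=
    eq_of_subset_of_card_le hsub (by omega)
  have hfinj : Function.Injective f := by
    rw [← Set.injOn_univ, ← coe_univ]
    refine card_image_iff.1 ?_
    rw [← heq, hcg, card_univ, Multiset.card_coe]
    exact le_antisymm (by rw [← hcg, heq]; exact hcf) hle
  have hval : ∀ y : n.ToType, partsExponent m (f y) = y.1 := by
    intro y
    rw [← hf, Finsupp.finsetSum_apply, Finset.sum_eq_single y]
    · simp
    · intro z _ hz
      exact Finsupp.single_eq_of_ne fun h => hz (hfinj h.symm)
    · simp
  have key : ∀ (k : Multiset ℕ) (u : k.ToType → ℕ+), Function.Injective u →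
      (∀ y, partsExponent m (u y) = y.1) → k = (univ.image u).val.map (partsExponent m) := by
    intro k u hu hk
    rw [image_val_of_injOn hu.injOn, Multiset.map_map]
    conv_lhs => rw [← Multiset.map_univ_coe k]
    exact Multiset.map_congr rfl fun y _ => (hk y).symm
  exact (key n f hfinj hval).trans (by rw [← heq]; exact (key m g hginj (partsExponent_apply m)).symm)

/-- Products of power sums are linearly independent. -/
theorem eq_zero_of_sum_powerSumCoeff_eq_zero (c : Multiset ℕ →₀ ℤ)
    (hpos : ∀ m ∈ c.support, ∀ k ∈ m, 0 < k)
    (h : ∀ d, c.sum (fun m a => a * (powerSumCoeff m d : ℤ)) = 0) : c = 0 := by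
  classical
  by_contra hc
  -- For `m` with the most parts, the monomial `partsExponent m` occurs in no other product of the
  -- support.
  obtain ⟨m, hm, hmax⟩ := exists_max_image c.support Multiset.card (Finsupp.support_nonempty_iff.2 hc)
  have h1 := h (partsExponent m)
  rw [Finsupp.sum, Finset.sum_eq_single m] at h1
  · rcases mul_eq_zero.1 h1 with h2 | h2
    · exact (Finsupp.mem_support_iff.1 hm) h2
    · exact powerSumCoeff_partsExponent_self (hpos m hm) (by exact_mod_cast h2)
  · intro n hn hne
    by_contra h2
    refine hne (eq_of_powerSumCoeff_partsExponent_ne_zero (hpos m hm) (hmax n hn) ?_)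
    intro h3
    exact h2 (by rw [h3]; simp)
  · intro h2
    exact absurd hm h2

end PowerSums

namespace SimpleGraph

open Finset

/-! ### Power sum expansion of the chromatic symmetric function. -/

section PowerSumExpansion

variable {V : Type*} [Fintype V]

open Classical in
/-- The multiset of the sizes of the connected components of the spanning graph with edge set
`A`. -/
noncomputable def componentSizes (A : Finset (Sym2 V)) : Multiset ℕ :=
  (univ : Finset (fromEdgeSet (A : Set (Sym2 V))).ConnectedComponent).val.map
    fun c => #{v | (fromEdgeSet (A : Set (Sym2 V))).connectedComponentMk v = c}

theorem pos_of_mem_componentSizes {A : Finset (Sym2 V)} {k : ℕ} (hk : k ∈ componentSizes A) :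
    0 < k := by
  classical
  obtain ⟨c, -, rfl⟩ := Multiset.mem_map.1 hk
  obtain ⟨v, rfl⟩ := c.exists_rep
  refine card_pos.2 ⟨v, ?_⟩
  rw [mem_filter]
  exact ⟨mem_univ v, rfl⟩

/-- A map that is constant along every edge of `A` is the same as a coloring of the components. -/
theorem card_colorings_eq_powerSumCoeff (A : Finset (Sym2 V)) (d : ℕ+ →₀ ℕ) :
    Nat.card {κ : V → ℕ+ // ∑ v, Finsupp.single (κ v) 1 = d ∧ ∀ e ∈ A, (e.map κ).IsDiag} =
      powerSumCoeff (componentSizes A) d := by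
  classical
  unfold componentSizes
  rw [← card_eq_powerSumCoeff]
  set Γ := fromEdgeSet (A : Set (Sym2 V)) with hΓ
  have hsum : ∀ f : Γ.ConnectedComponent → ℕ+,
      ∑ v, Finsupp.single (f (Γ.connectedComponentMk v)) 1 =
        ∑ c, Finsupp.single (f c) #{v | Γ.connectedComponentMk v = c} := by
    intro f
    rw [← Finset.sum_fiberwise univ Γ.connectedComponentMk]
    refine Finset.sum_congr rfl fun c _ => ?_
    rw [Finset.sum_congr rfl (g := fun _ => Finsupp.single (f c) 1)]
    · rw [sum_const, Finsupp.smul_single, smul_eq_mul, mul_one]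
    · intro v hv
      rw [(mem_filter.1 hv).2]
  symm
  refine Nat.card_congr (Equiv.ofBijective (fun f => ⟨fun v => f.1 (Γ.connectedComponentMk v),
    by rw [hsum]; exact f.2, ?_⟩) ⟨?_, ?_⟩)
  · intro e
    induction e with | _ x y
    intro he
    rw [Sym2.map_mk, Sym2.mk_isDiag_iff]
    by_cases hxy : x = y
    · rw [hxy]
    · have : Γ.Adj x y := by
        rw [hΓ, fromEdgeSet_adj]
        exact ⟨he, hxy⟩
      rw [ConnectedComponent.sound this.reachable]
  · intro f g hfg
    refine Subtype.ext (funext fun c => ?_)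
    obtain ⟨v, rfl⟩ := c.exists_rep
    exact congrFun (congrArg Subtype.val hfg) v
  · rintro ⟨κ, hκ, hA⟩
    have hadj : ∀ v w, Γ.Adj v w → κ v = κ w := by
      intro v w hvw
      rw [hΓ, fromEdgeSet_adj] at hvw
      have := hA _ hvw.1
      rwa [Sym2.map_mk, Sym2.mk_isDiag_iff] at this
    have hw : ∀ v w (p : Γ.Walk v w), κ v = κ w := by
      intro v w p
      induction p with
      | nil => rfl
      | cons h _ ih => rw [hadj _ _ h, ih]
    refine ⟨⟨ConnectedComponent.lift κ fun v w p _ => hw v w p, ?_⟩, ?_⟩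
    · rw [← hsum]
      exact hκ
    · rfl

/-- The expansion of the chromatic symmetric function in products of power sums. -/
noncomputable def powerSumExpansion (G : SimpleGraph V) : Multiset ℕ →₀ ℤ := by
  classical
  exact ∑ A ∈ G.edgeFinset.powerset, Finsupp.single (componentSizes A) ((-1) ^ #A)

/-- Expand, for each map `κ`, the indicator of properness `∏ e, (1 - [κ is constant on e])` over the
sets of edges, then exchange the sums. -/
theorem coe_chromaticSymmetricFunction_eq_sum (G : SimpleGraph V) (d : ℕ+ →₀ ℕ) :
    ((G.finite_coloringExponent_eq d).toFinset.card : ℤ) =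
      (powerSumExpansion G).sum fun m a => a * (powerSumCoeff m d : ℤ) := by
  classical
  have hfin : {κ : V → ℕ+ | ∑ v, Finsupp.single (κ v) 1 = d}.Finite := by
    -- Every map is a proper coloring of the edgeless graph.
    refine (Set.Finite.image (fun κ : (⊥ : SimpleGraph V).Coloring ℕ+ => (κ : V → ℕ+))
      (finite_coloringExponent_eq (⊥ : SimpleGraph V) d)).subset ?_
    intro κ hκ
    exact ⟨⟨κ, fun h => absurd h (by simp)⟩, hκ, rfl⟩
  set F := hfin.toFinset with hF
  have hmemF : ∀ κ, κ ∈ F ↔ ∑ v, Finsupp.single (κ v) 1 = d := fun κ => by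
    rw [hF, Set.Finite.mem_toFinset]; rfl
  have h1 : (G.finite_coloringExponent_eq d).toFinset.card =
      #{κ ∈ F | ∀ e ∈ G.edgeFinset, ¬ (e.map κ).IsDiag} := by
    refine card_bij (fun κ _ => (κ : V → ℕ+)) ?_ (fun _ _ _ _ h => DFunLike.coe_injective h) ?_
    · intro κ hκ
      rw [Set.Finite.mem_toFinset] at hκ
      refine mem_filter.2 ⟨(hmemF _).2 hκ, fun e => ?_⟩
      induction e with | _ x y
      rw [mem_edgeFinset, mem_edgeSet, Sym2.map_mk, Sym2.mk_isDiag_iff]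
      exact fun h => κ.valid h
    · intro κ hκ
      obtain ⟨hκF, hκ'⟩ := mem_filter.1 hκ
      refine ⟨⟨κ, fun {x y} h => ?_⟩, ?_, rfl⟩
      · have := hκ' s(x, y) (by rwa [mem_edgeFinset, mem_edgeSet])
        rwa [Sym2.map_mk, Sym2.mk_isDiag_iff] at this
      · rw [Set.Finite.mem_toFinset]
        exact (hmemF _).1 hκF
  have h2 : (#{κ ∈ F | ∀ e ∈ G.edgeFinset, ¬ (e.map κ).IsDiag} : ℤ) =
      ∑ A ∈ G.edgeFinset.powerset, (-1) ^ #A * (powerSumCoeff (componentSizes A) d : ℤ) := by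
    rw [card_filter]
    push_cast
    have : ∀ κ : V → ℕ+, (if ∀ e ∈ G.edgeFinset, ¬ (e.map κ).IsDiag then (1 : ℤ) else 0) =
        ∑ A ∈ G.edgeFinset.powerset, (-1) ^ #A * if ∀ e ∈ A, (e.map κ).IsDiag then 1 else 0 := by
      intro κ
      have hp : (if ∀ e ∈ G.edgeFinset, ¬ (e.map κ).IsDiag then (1 : ℤ) else 0) =
          ∏ e ∈ G.edgeFinset, (1 - if (e.map κ).IsDiag then (1 : ℤ) else 0) := by
        rw [prod_congr rfl (g := fun e => if ¬ (e.map κ).IsDiag then (1 : ℤ) else 0),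
          prod_ite_zero, prod_const_one]
        · congr!
        · intro e _
          by_cases h : (e.map κ).IsDiag <;> simp [h]
      rw [hp, prod_sub]
      refine Finset.sum_congr rfl fun A _ => ?_
      rw [prod_const_one, mul_one, prod_ite_zero, prod_const_one]
      congr!
    rw [Finset.sum_congr rfl fun κ _ => this κ, Finset.sum_comm]
    refine Finset.sum_congr rfl fun A _ => ?_
    rw [← mul_sum, ← card_colorings_eq_powerSumCoeff]
    congr 1
    rw [← Nat.cast_one, ← Nat.cast_zero]
    simp_rw [← Nat.cast_ite]
    rw [← Nat.cast_sum, ← card_filter, Nat.cast_inj, ← Nat.card_eq_finsetCard]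
    exact Nat.card_congr (Equiv.subtypeEquivRight fun κ => by rw [mem_filter, hmemF])
  rw [h1, h2, powerSumExpansion, ← Finsupp.sum_finsetSum_index]
  · refine Finset.sum_congr rfl fun A _ => ?_
    rw [Finsupp.sum_single_index]
    simp
  · simp
  · intros
    ring

theorem pos_of_mem_support_powerSumExpansion (G : SimpleGraph V) {m : Multiset ℕ}
    (hm : m ∈ (powerSumExpansion G).support) {k : ℕ} (hk : k ∈ m) : 0 < k := by
  classical
  rw [powerSumExpansion] at hm
  obtain ⟨A, -, hA⟩ := mem_biUnion.1 (Finsupp.support_finsetSum hm)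
  have := mem_singleton.1 (Finsupp.support_single_subset hA)
  subst this
  exact pos_of_mem_componentSizes hk

theorem powerSumExpansion_eq {W : Type*} [Fintype W] {G : SimpleGraph V} {H : SimpleGraph W}
    (hX : G.chromaticSymmetricFunction = H.chromaticSymmetricFunction) :
    powerSumExpansion G = powerSumExpansion H := by
  classical
  refine sub_eq_zero.1 (eq_zero_of_sum_powerSumCoeff_eq_zero _ ?_ fun d => ?_)
  · intro m hm k hk
    rcases mem_union.1 (Finsupp.support_sub hm) with h | h
    · exact pos_of_mem_support_powerSumExpansion G h hk
    · exact pos_of_mem_support_powerSumExpansion H h hk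
  · rw [Finsupp.sum_sub_index (fun _ _ _ => by ring), ← coe_chromaticSymmetricFunction_eq_sum,
      ← coe_chromaticSymmetricFunction_eq_sum, sub_eq_zero]
    have hd := congrFun hX d
    unfold chromaticSymmetricFunction at hd
    exact_mod_cast hd

theorem powerSumExpansion_apply (G : SimpleGraph V) [DecidableEq V] [DecidableRel G.Adj]
    (m : Multiset ℕ) :
    powerSumExpansion G m = ∑ A ∈ G.edgeFinset.powerset with componentSizes A = m, (-1) ^ #A := by
  classical
  rw [powerSumExpansion, Finsupp.finsetSum_apply, sum_filter]
  refine Finset.sum_congr (by congr!) fun A _ => ?_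
  rw [Finsupp.single_apply]

theorem exists_of_powerSumExpansion_ne_zero {G : SimpleGraph V} {m : Multiset ℕ}
    (h : powerSumExpansion G m ≠ 0) :
    ∃ A : Finset (Sym2 V), (A : Set (Sym2 V)) ⊆ G.edgeSet ∧ componentSizes A = m := by
  classical
  rw [powerSumExpansion_apply] at h
  obtain ⟨A, hA, -⟩ := exists_ne_zero_of_sum_ne_zero h
  obtain ⟨hA, hm⟩ := mem_filter.1 hA
  refine ⟨A, fun e he => ?_, hm⟩
  exact mem_edgeFinset.1 (mem_powerset.1 hA he)

/-- All contributions carry the same sign, so they cannot cancel. -/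
theorem powerSumExpansion_ne_zero {G : SimpleGraph V} {A : Finset (Sym2 V)}
    (hA : (A : Set (Sym2 V)) ⊆ G.edgeSet)
    (h : ∀ A' : Finset (Sym2 V), (A' : Set (Sym2 V)) ⊆ G.edgeSet →
      componentSizes A' = componentSizes A → #A' = #A) :
    powerSumExpansion G (componentSizes A) ≠ 0 := by
  classical
  rw [powerSumExpansion_apply, Finset.sum_congr rfl (g := fun _ => (-1 : ℤ) ^ #A)]
  · rw [sum_const, nsmul_eq_mul]
    refine mul_ne_zero ?_ (by simp)
    rw [Nat.cast_ne_zero, card_ne_zero]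
    exact ⟨A, mem_filter.2 ⟨mem_powerset.2 fun e he => mem_edgeFinset.2 (hA he), rfl⟩⟩
  · intro A' hA'
    obtain ⟨hA', hm⟩ := mem_filter.1 hA'
    rw [h A' (fun e he => mem_edgeFinset.1 (mem_powerset.1 hA' he)) hm]

end PowerSumExpansion

/-! ### Edge sets without isolated vertices in a graph with leaves. -/

section LeafRetraction

variable {V : Type*}

/-- `r` fixes the vertices of a core of `G` and sends every other vertex to its only neighbor,
which lies in the core. -/
structure IsLeafRetraction (G : SimpleGraph V) (r : V → V) : Prop where
  idem : ∀ x, r (r x) = r x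
  adj_iff : ∀ x y, r x ≠ x → (G.Adj x y ↔ y = r x)

variable [Fintype V]

open Classical in
/-- The fixed points of `r`. -/
noncomputable def coreVerts (r : V → V) : Finset V := {x | r x = x}

open Classical in
/-- The number of vertices that `r` sends to `u`. -/
noncomputable def clusterSize (r : V → V) (u : V) : ℕ := #{x | r x = u}

open Classical in
/-- The edges joining a vertex outside the core to the core. -/
noncomputable def pendantEdges (r : V → V) : Finset (Sym2 V) :=
  ({x | r x ≠ x} : Finset V).image fun x => s(x, r x)

theorem mem_coreVerts {r : V → V} {x : V} : x ∈ coreVerts r ↔ r x = x := by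
  simp [coreVerts]

theorem mem_pendantEdges {r : V → V} {x : V} (hx : r x ≠ x) : s(x, r x) ∈ pendantEdges r := by
  simp only [pendantEdges, mem_image, mem_filter, mem_univ, true_and]
  exact ⟨x, hx, rfl⟩

theorem exists_of_mem_pendantEdges {r : V → V} {x y : V} (h : s(x, y) ∈ pendantEdges r) :
    (r x ≠ x ∧ y = r x) ∨ (r y ≠ y ∧ x = r y) := by
  simp only [pendantEdges, mem_image, mem_filter, mem_univ, true_and] at h
  obtain ⟨z, hz, h⟩ := h
  rcases Sym2.eq_iff.1 h with ⟨rfl, rfl⟩ | ⟨rfl, rfl⟩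
  · exact Or.inl ⟨hz, rfl⟩
  · exact Or.inr ⟨hz, rfl⟩

open Classical in
-- The map `g` chooses a representative in each component.
theorem componentSizes_eq_map {A : Finset (Sym2 V)} (g : V → V)
    (hadj : ∀ x y, s(x, y) ∈ A → g x = g y)
    (hreach : ∀ x, (fromEdgeSet (A : Set (Sym2 V))).Reachable x (g x)) :
    componentSizes A = (univ.image g).val.map fun i => #{x | g x = i} := by
  unfold componentSizes
  set Γ := fromEdgeSet (A : Set (Sym2 V)) with hΓ
  have hw : ∀ v w (p : Γ.Walk v w), g v = g w := by
    intro v w p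
    induction p with
    | nil => rfl
    | cons h _ ih =>
      rw [hΓ, fromEdgeSet_adj] at h
      rw [hadj _ _ h.1, ih]
  let f : Γ.ConnectedComponent → V := ConnectedComponent.lift g fun v w p _ => hw v w p
  have hf : ∀ x, f (Γ.connectedComponentMk x) = g x := fun _ => rfl
  have hinj : Function.Injective f := by
    intro c c' h
    obtain ⟨x, rfl⟩ := c.exists_rep
    obtain ⟨y, rfl⟩ := c'.exists_rep
    have h' : g x = g y := h
    refine ConnectedComponent.sound ((hreach x).trans ?_)
    rw [h']
    exact (hreach y).symm
  have himg : univ.image g = univ.image f := by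
    ext i
    simp only [mem_image, mem_univ, true_and]
    constructor
    · rintro ⟨x, rfl⟩
      exact ⟨_, hf x⟩
    · rintro ⟨c, rfl⟩
      obtain ⟨x, rfl⟩ := c.exists_rep
      exact ⟨x, rfl⟩
  rw [himg, image_val_of_injOn hinj.injOn, Multiset.map_map]
  refine Multiset.map_congr rfl fun c _ => ?_
  simp only [Function.comp]
  congr 1
  ext x
  simp only [mem_filter, mem_univ, true_and]
  rw [← hf, hinj.eq_iff]

theorem reachable_of_pendantEdges_subset {r : V → V} {A : Finset (Sym2 V)}
    (hA : pendantEdges r ⊆ A) (x : V) :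
    (fromEdgeSet (A : Set (Sym2 V))).Reachable x (r x) := by
  by_cases hx : r x = x
  · rw [hx]
  · refine Adj.reachable ?_
    rw [fromEdgeSet_adj]
    exact ⟨hA (mem_pendantEdges hx), Ne.symm hx⟩

theorem componentSizes_pendantEdges {r : V → V} (idem : ∀ x, r (r x) = r x) :
    componentSizes (pendantEdges r) = (coreVerts r).val.map (clusterSize r) := by
  classical
  rw [componentSizes_eq_map r]
  · have : univ.image r = coreVerts r := by
      ext i
      simp only [mem_image, mem_univ, true_and, mem_coreVerts]
      constructor
      · rintro ⟨x, rfl⟩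
        exact idem x
      · exact fun h => ⟨i, h⟩
    rw [this]
    refine Multiset.map_congr rfl fun i _ => ?_
    unfold clusterSize
    congr!
  · intro x y h
    rcases exists_of_mem_pendantEdges h with ⟨-, rfl⟩ | ⟨-, rfl⟩
    · exact (idem x).symm
    · exact idem y
  · exact reachable_of_pendantEdges_subset Subset.rfl

open Classical in
theorem componentSizes_insert_pendantEdges {r : V → V} (idem : ∀ x, r (r x) = r x) {u v : V}
    (hu : r u = u) (hv : r v = v) (huv : u ≠ v) :
    componentSizes (insert s(u, v) (pendantEdges r)) = ((coreVerts r).erase v).val.map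
      fun w => if w = u then clusterSize r u + clusterSize r v else clusterSize r w := by
  -- The new edge merges the clusters of `u` and `v`; `u` represents both.
  rw [componentSizes_eq_map fun x => if r x = v then u else r x]
  · have : (univ.image fun x => if r x = v then u else r x) = (coreVerts r).erase v := by
      ext i
      simp only [mem_image, mem_univ, true_and, mem_erase, mem_coreVerts]
      constructor
      · rintro ⟨x, rfl⟩
        split_ifs with h
        · exact ⟨huv, hu⟩
        · exact ⟨h, idem x⟩
      · rintro ⟨h1, h2⟩
        exact ⟨i, by rw [h2, if_neg h1]⟩
    rw [this]
    refine Multiset.map_congr rfl fun i hi => ?_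
    have hiv : i ≠ v := (mem_erase.1 hi).1
    unfold clusterSize
    split_ifs with h
    · subst h
      rw [← card_union_of_disjoint]
      · congr 1
        ext x
        simp only [mem_filter, mem_univ, true_and, mem_union]
        split_ifs with h
        · simp [h]
        · simp [h]
      · rw [disjoint_filter]
        rintro x - h1 h2
        exact hiv (h1.symm.trans h2)
    · congr 1
      ext x
      simp only [mem_filter, mem_univ, true_and]
      split_ifs with h'
      · rw [h']
        exact ⟨fun e => absurd e.symm h, fun e => absurd e.symm hiv⟩
      · rfl
  · intro x y h
    rcases mem_insert.1 h with h | h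
    · rcases Sym2.eq_iff.1 h with ⟨rfl, rfl⟩ | ⟨rfl, rfl⟩
      · simp [hu, hv]
      · simp [hu, hv]
    · rcases exists_of_mem_pendantEdges h with ⟨-, rfl⟩ | ⟨-, rfl⟩
      · simp only [idem]
      · simp only [idem]
  · intro x
    have h1 := reachable_of_pendantEdges_subset (subset_insert s(u, v) (pendantEdges r)) x
    split_ifs with h
    · rw [h] at h1
      refine h1.trans (Adj.reachable ?_)
      rw [fromEdgeSet_adj]
      exact ⟨by simp [Sym2.eq_swap], huv.symm⟩
    · exact h1

variable {G : SimpleGraph V} {r : V → V}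

theorem IsLeafRetraction.pendantEdges_subset_edgeSet (hr : G.IsLeafRetraction r) :
    (pendantEdges r : Set (Sym2 V)) ⊆ G.edgeSet := by
  intro e he
  induction e with | _ x y
  rw [mem_edgeSet]
  rcases exists_of_mem_pendantEdges he with ⟨h, h'⟩ | ⟨h, h'⟩
  · exact (hr.adj_iff _ _ h).2 h'
  · exact ((hr.adj_iff _ _ h).2 h').symm

/-- A leaf whose pendant edge is missing would be a component of size 1. -/
theorem IsLeafRetraction.pendantEdges_subset (hr : G.IsLeafRetraction r) {A : Finset (Sym2 V)}
    (hA : (A : Set (Sym2 V)) ⊆ G.edgeSet) (hunit : ∀ k ∈ componentSizes A, 2 ≤ k) :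
    pendantEdges r ⊆ A := by
  classical
  intro e he
  simp only [pendantEdges, mem_image, mem_filter, mem_univ, true_and] at he
  obtain ⟨x, hx, rfl⟩ := he
  have h2 := hunit _ (Multiset.mem_map.2
    ⟨(fromEdgeSet (A : Set (Sym2 V))).connectedComponentMk x, mem_univ _, rfl⟩)
  obtain ⟨y, hy, hyx⟩ := exists_mem_ne (one_lt_two.trans_le h2) x
  have hreach : (fromEdgeSet (A : Set (Sym2 V))).Reachable x y :=
    (ConnectedComponent.exact (mem_filter.1 hy).2).symm
  obtain ⟨p⟩ := hreach
  cases p with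
  | nil => exact absurd rfl hyx
  | cons h _ =>
    rw [fromEdgeSet_adj] at h
    rw [← (hr.adj_iff x _ hx).1 ((mem_edgeSet G).1 (hA h.1))]
    exact h.1

theorem IsLeafRetraction.exists_of_mem_of_notMem (hr : G.IsLeafRetraction r) {e : Sym2 V}
    (he : e ∈ G.edgeSet) (h : e ∉ pendantEdges r) :
    ∃ u v, e = s(u, v) ∧ r u = u ∧ r v = v ∧ G.Adj u v := by
  induction e with | _ u v
  rw [mem_edgeSet] at he
  refine ⟨u, v, rfl, ?_, ?_, he⟩
  · by_contra hu
    have := (hr.adj_iff _ _ hu).1 he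
    rw [this] at h
    exact h (mem_pendantEdges hu)
  · by_contra hv
    have := (hr.adj_iff _ _ hv).1 he.symm
    rw [this, Sym2.eq_swap] at h
    exact h (mem_pendantEdges hv)

theorem card_componentSizes_le {A : Finset (Sym2 V)} (s : Finset V)
    (h : ∀ x, ∃ y ∈ s, (fromEdgeSet (A : Set (Sym2 V))).Reachable x y) :
    (componentSizes A).card ≤ #s := by
  classical
  rw [componentSizes, Multiset.card_map]
  refine card_le_card_of_surjOn (fromEdgeSet (A : Set (Sym2 V))).connectedComponentMk ?_
  intro c _
  obtain ⟨x, rfl⟩ := c.exists_rep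
  obtain ⟨y, hy, hxy⟩ := h x
  exact ⟨y, hy, ConnectedComponent.sound hxy.symm⟩

theorem card_componentSizes_le_coreVerts (idem : ∀ x, r (r x) = r x) {A : Finset (Sym2 V)}
    (hA : pendantEdges r ⊆ A) : (componentSizes A).card ≤ #(coreVerts r) :=
  card_componentSizes_le _ fun x =>
    ⟨r x, mem_coreVerts.2 (idem x), reachable_of_pendantEdges_subset hA x⟩

theorem card_componentSizes_lt_of_mem (idem : ∀ x, r (r x) = r x) {A : Finset (Sym2 V)}
    (hA : pendantEdges r ⊆ A) {u v : V} (hu : r u = u) (hv : r v = v) (huv : u ≠ v)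
    (h : s(u, v) ∈ A) : (componentSizes A).card < #(coreVerts r) := by
  classical
  refine lt_of_le_of_lt (card_componentSizes_le ((coreVerts r).erase u) fun x => ?_)
    (card_erase_lt_of_mem (mem_coreVerts.2 hu))
  have hx := reachable_of_pendantEdges_subset hA x
  by_cases hxu : r x = u
  · refine ⟨v, mem_erase.2 ⟨huv.symm, mem_coreVerts.2 hv⟩, hx.trans (Adj.reachable ?_)⟩
    rw [hxu, fromEdgeSet_adj]
    exact ⟨h, huv⟩
  · exact ⟨r x, mem_erase.2 ⟨hxu, mem_coreVerts.2 (idem x)⟩, hx⟩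

/-- Neither `u` nor `x` is needed as a representative: pass from `u` to `v`, and from there, if `v =
x`, on to `y`, which differs from `u`. -/
theorem card_componentSizes_add_one_lt_of_mem (idem : ∀ x, r (r x) = r x) {A : Finset (Sym2 V)}
    (hA : pendantEdges r ⊆ A) {u v x y : V} (hu : r u = u) (hv : r v = v) (huv : u ≠ v)
    (h : s(u, v) ∈ A) (hx : r x = x) (hy : r y = y) (hxy : x ≠ y) (h' : s(x, y) ∈ A)
    (hux : u ≠ x) (huy : u ≠ y) : (componentSizes A).card + 1 < #(coreVerts r) := by
  classical
  have hcard := card_erase_add_one (mem_coreVerts.2 hu)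
  have hcard' := card_erase_add_one (mem_erase.2 ⟨hux.symm, mem_coreVerts.2 hx⟩)
  have hle := card_componentSizes_le (A := A) (((coreVerts r).erase u).erase x) fun z => ?_
  · omega
  have hadj : ∀ {a b : V}, s(a, b) ∈ A → a ≠ b → (fromEdgeSet (A : Set (Sym2 V))).Reachable a b :=
    fun hm hne => Adj.reachable (by rw [fromEdgeSet_adj]; exact ⟨hm, hne⟩)
  have hmem : ∀ w, r w = w → w ≠ u →
      ∃ y ∈ ((coreVerts r).erase u).erase x, (fromEdgeSet (A : Set (Sym2 V))).Reachable w y := by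
    intro w hw hwu
    by_cases hwx : w = x
    · subst hwx
      exact ⟨y, by simp [hxy.symm, huy.symm, mem_coreVerts, hy], hadj h' hxy⟩
    · exact ⟨w, by simp [hwx, hwu, mem_coreVerts, hw], Reachable.refl w⟩
  have hz := reachable_of_pendantEdges_subset hA z
  by_cases hzu : r z = u
  · obtain ⟨w, hw, hvw⟩ := hmem v hv huv.symm
    rw [hzu] at hz
    exact ⟨w, hw, (hz.trans (hadj h huv)).trans hvw⟩
  · obtain ⟨w, hw, hvw⟩ := hmem (r z) (idem z) hzu
    exact ⟨w, hw, hz.trans hvw⟩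

theorem IsLeafRetraction.eq_pendantEdges (hr : G.IsLeafRetraction r) {A : Finset (Sym2 V)}
    (hA : (A : Set (Sym2 V)) ⊆ G.edgeSet) (hunit : ∀ k ∈ componentSizes A, 2 ≤ k)
    (hcard : (componentSizes A).card = #(coreVerts r)) : A = pendantEdges r := by
  have hsub := hr.pendantEdges_subset hA hunit
  refine Subset.antisymm (fun e he => ?_) hsub
  by_contra hne
  obtain ⟨u, v, rfl, hu, hv, huv⟩ := hr.exists_of_mem_of_notMem (hA he) hne
  exact (card_componentSizes_lt_of_mem hr.idem hsub hu hv huv.ne he).ne hcard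

open Classical in
theorem IsLeafRetraction.exists_eq_insert_pendantEdges (hr : G.IsLeafRetraction r)
    {A : Finset (Sym2 V)} (hA : (A : Set (Sym2 V)) ⊆ G.edgeSet)
    (hunit : ∀ k ∈ componentSizes A, 2 ≤ k)
    (hcard : (componentSizes A).card + 1 = #(coreVerts r)) :
    ∃ u v, r u = u ∧ r v = v ∧ G.Adj u v ∧ s(u, v) ∉ pendantEdges r ∧
      A = insert s(u, v) (pendantEdges r) := by
  have hsub := hr.pendantEdges_subset hA hunit
  obtain ⟨e, he, hne⟩ : ∃ e ∈ A, e ∉ pendantEdges r := by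
    by_contra! hcon
    have : A = pendantEdges r := Subset.antisymm hcon hsub
    rw [this, componentSizes_pendantEdges hr.idem, Multiset.card_map] at hcard
    exact absurd hcard (Nat.succ_ne_self _)
  obtain ⟨u, v, rfl, hu, hv, huv⟩ := hr.exists_of_mem_of_notMem (hA he) hne
  refine ⟨u, v, hu, hv, huv, hne, Subset.antisymm (fun e' he' => ?_) (insert_subset he hsub)⟩
  by_contra hne'
  obtain ⟨hee', hne'⟩ := not_or.1 (mem_insert.not.1 hne')
  obtain ⟨x, y, rfl, hx, hy, hxy⟩ := hr.exists_of_mem_of_notMem (hA he') hne'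
  -- Distinct edges share at most one endpoint, so `u` or `v` lies off `s(x, y)`, which is all the
  -- count requires.
  by_cases h : u = x ∨ u = y
  · have hvx : v ≠ x := by
      rintro rfl
      rcases h with rfl | rfl
      · exact huv.ne rfl
      · exact hee' Sym2.eq_swap
    have hvy : v ≠ y := by
      rintro rfl
      rcases h with rfl | rfl
      · exact hee' rfl
      · exact huv.ne rfl
    have := card_componentSizes_add_one_lt_of_mem hr.idem hsub hv hu huv.ne.symm
      (by rwa [Sym2.eq_swap]) hx hy hxy.ne he' hvx hvy
    omega
  · obtain ⟨hux, huy⟩ := not_or.1 h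
    have := card_componentSizes_add_one_lt_of_mem hr.idem hsub hu hv huv.ne he hx hy hxy.ne he'
      hux huy
    omega

end LeafRetraction

/-! ### Reconstruction of the graph from its expansion. -/

section Reconstruction

variable {V W : Type*} [Fintype V] [Fintype W]

/-- A leaf retraction whose clusters have pairwise distinct sizes, all greater than `1`. -/
structure IsDistinctLeafRetraction (G : SimpleGraph V) (r : V → V) : Prop
    extends G.IsLeafRetraction r where
  two_le : ∀ u, r u = u → 2 ≤ clusterSize r u
  inj : ∀ u v, r u = u → r v = v → clusterSize r u = clusterSize r v → u = v

variable {G : SimpleGraph V} {r : V → V} {H : SimpleGraph W} {s : W → W}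

theorem notMem_pendantEdges {u v : V} (hu : r u = u) (hv : r v = v) :
    s(u, v) ∉ pendantEdges r := fun h => by
  rcases exists_of_mem_pendantEdges h with ⟨h, -⟩ | ⟨h, -⟩
  · exact h hu
  · exact h hv

namespace IsDistinctLeafRetraction

theorem two_le_of_mem_componentSizes (hr : G.IsDistinctLeafRetraction r) :
    ∀ k ∈ componentSizes (pendantEdges r), 2 ≤ k := by
  intro k hk
  rw [componentSizes_pendantEdges hr.idem] at hk
  obtain ⟨u, hu, rfl⟩ := Multiset.mem_map.1 hk
  exact hr.two_le u (mem_coreVerts.1 hu)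

theorem powerSumExpansion_pendantEdges_ne_zero (hr : G.IsDistinctLeafRetraction r) :
    powerSumExpansion G (componentSizes (pendantEdges r)) ≠ 0 := by
  refine powerSumExpansion_ne_zero hr.pendantEdges_subset_edgeSet fun A hA h => ?_
  rw [hr.eq_pendantEdges hA]
  · rw [h]
    exact hr.two_le_of_mem_componentSizes
  · rw [h, componentSizes_pendantEdges hr.idem, Multiset.card_map]
    rfl

open Classical in
theorem two_le_of_mem_componentSizes_insert (hr : G.IsDistinctLeafRetraction r) {u v : V}
    (hu : r u = u) (hv : r v = v) (huv : G.Adj u v) :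
    ∀ k ∈ componentSizes (insert s(u, v) (pendantEdges r)), 2 ≤ k := by
  intro k hk
  rw [componentSizes_insert_pendantEdges hr.idem hu hv huv.ne] at hk
  obtain ⟨w, hw, rfl⟩ := Multiset.mem_map.1 hk
  split_ifs
  · exact (hr.two_le u hu).trans (Nat.le_add_right _ _)
  · exact hr.two_le w (mem_coreVerts.1 (mem_of_mem_erase hw))

open Classical in
theorem card_componentSizes_insert (hr : G.IsDistinctLeafRetraction r) {u v : V}
    (hu : r u = u) (hv : r v = v) (huv : G.Adj u v) :
    (componentSizes (insert s(u, v) (pendantEdges r))).card + 1 = #(coreVerts r) := by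
  rw [componentSizes_insert_pendantEdges hr.idem hu hv huv.ne, Multiset.card_map]
  exact card_erase_add_one (mem_coreVerts.2 hv)

open Classical in
theorem powerSumExpansion_insert_ne_zero (hr : G.IsDistinctLeafRetraction r) {u v : V}
    (hu : r u = u) (hv : r v = v) (huv : G.Adj u v) :
    powerSumExpansion G (componentSizes (insert s(u, v) (pendantEdges r))) ≠ 0 := by
  refine powerSumExpansion_ne_zero ?_ fun A hA h => ?_
  · rw [coe_insert, Set.insert_subset_iff]
    exact ⟨huv, hr.pendantEdges_subset_edgeSet⟩
  · obtain ⟨x, y, hx, hy, hxy, hne, rfl⟩ := hr.exists_eq_insert_pendantEdges hA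
      (by rw [h]; exact hr.two_le_of_mem_componentSizes_insert hu hv huv)
      (by rw [h]; exact hr.card_componentSizes_insert hu hv huv)
    rw [card_insert_of_notMem hne, card_insert_of_notMem (notMem_pendantEdges hu hv)]

open Classical in
-- The merged size may coincide with that of a third cluster, but it exceeds both sizes that it
-- replaces, and no other cluster has either of these.
theorem clusterSize_notMem_componentSizes_insert (hr : G.IsDistinctLeafRetraction r) {u v : V}
    (hu : r u = u) (hv : r v = v) (huv : G.Adj u v) {x : V} (hx : r x = x) :
    clusterSize r x ∉ componentSizes (insert s(u, v) (pendantEdges r)) ↔ x = u ∨ x = v := by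
  have h2u := hr.two_le u hu
  have h2v := hr.two_le v hv
  rw [componentSizes_insert_pendantEdges hr.idem hu hv huv.ne]
  constructor
  · intro h
    by_contra! hne
    refine h (Multiset.mem_map.2 ⟨x, mem_erase.2 ⟨hne.2, mem_coreVerts.2 hx⟩, ?_⟩)
    rw [if_neg hne.1]
  · intro hxuv h
    obtain ⟨w, hw, hwx⟩ := Multiset.mem_map.1 h
    obtain ⟨hwv, hw⟩ := mem_erase.1 hw
    split_ifs at hwx with hwu
    · rcases hxuv with rfl | rfl <;> omega
    · have := hr.inj w x (mem_coreVerts.1 hw) hx hwx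
      subst this
      exact hxuv.elim hwu hwv

/-- The type of the pendant edges of `G` is realized in `H` by an edge set containing all pendant
edges of `H`, which bounds its number of parts. -/
theorem card_coreVerts_le (hr : G.IsDistinctLeafRetraction r) (hs : H.IsDistinctLeafRetraction s)
    (h : powerSumExpansion G = powerSumExpansion H) : #(coreVerts r) ≤ #(coreVerts s) := by
  have h0 := hr.powerSumExpansion_pendantEdges_ne_zero
  rw [h] at h0
  obtain ⟨A, hA, hAr⟩ := exists_of_powerSumExpansion_ne_zero h0
  have hsub := hs.pendantEdges_subset hA (by rw [hAr]; exact hr.two_le_of_mem_componentSizes)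
  have hle := card_componentSizes_le_coreVerts hs.idem hsub
  rwa [hAr, componentSizes_pendantEdges hr.idem, Multiset.card_map] at hle

theorem map_clusterSize_eq (hr : G.IsDistinctLeafRetraction r) (hs : H.IsDistinctLeafRetraction s)
    (h : powerSumExpansion G = powerSumExpansion H) :
    (coreVerts r).val.map (clusterSize r) = (coreVerts s).val.map (clusterSize s) := by
  have h0 := hr.powerSumExpansion_pendantEdges_ne_zero
  rw [h] at h0
  obtain ⟨A, hA, hAr⟩ := exists_of_powerSumExpansion_ne_zero h0
  have hAs := hs.eq_pendantEdges hA (by rw [hAr]; exact hr.two_le_of_mem_componentSizes) (by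
    rw [hAr, componentSizes_pendantEdges hr.idem, Multiset.card_map]
    exact le_antisymm (hr.card_coreVerts_le hs h) (hs.card_coreVerts_le hr h.symm))
  rw [← componentSizes_pendantEdges hr.idem, ← componentSizes_pendantEdges hs.idem, ← hAr, hAs]

theorem exists_clusterSize_eq (hr : G.IsDistinctLeafRetraction r)
    (hs : H.IsDistinctLeafRetraction s) (h : powerSumExpansion G = powerSumExpansion H)
    (u : {x // r x = x}) : ∃ u' : {y // s y = y}, clusterSize s u' = clusterSize r u := by
  have hu : clusterSize r u ∈ (coreVerts r).val.map (clusterSize r) :=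
    Multiset.mem_map_of_mem _ (mem_coreVerts.2 u.2)
  rw [hr.map_clusterSize_eq hs h] at hu
  obtain ⟨u', hu', h'⟩ := Multiset.mem_map.1 hu
  exact ⟨⟨u', mem_coreVerts.1 hu'⟩, h'⟩

theorem exists_equiv_core (hr : G.IsDistinctLeafRetraction r) (hs : H.IsDistinctLeafRetraction s)
    (h : powerSumExpansion G = powerSumExpansion H) :
    ∃ φ : {x // r x = x} ≃ {y // s y = y}, ∀ u, clusterSize s (φ u) = clusterSize r u := by
  choose f hf using hr.exists_clusterSize_eq hs h
  choose g hg using hs.exists_clusterSize_eq hr h.symm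
  refine ⟨⟨f, g, fun u => ?_, fun u => ?_⟩, hf⟩
  · exact Subtype.ext (hr.inj _ _ (g (f u)).2 u.2 ((hg _).trans (hf _)))
  · exact Subtype.ext (hs.inj _ _ (f (g u)).2 u.2 ((hf _).trans (hg _)))

/-- The type obtained by merging `u` and `v` also occurs in `H`, where it must come from merging two
adjacent core vertices. The sizes missing from it force these to be `u'` and `v'`. -/
theorem adj_of_adj (hr : G.IsDistinctLeafRetraction r) (hs : H.IsDistinctLeafRetraction s)
    (h : powerSumExpansion G = powerSumExpansion H) {u v : V} {u' v' : W} (hu : r u = u)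
    (hv : r v = v) (hu' : s u' = u') (hv' : s v' = v') (huu' : clusterSize s u' = clusterSize r u)
    (hvv' : clusterSize s v' = clusterSize r v) (huv : G.Adj u v) : H.Adj u' v' := by
  classical
  have h0 := hr.powerSumExpansion_insert_ne_zero hu hv huv
  rw [h] at h0
  obtain ⟨A, hA, hAr⟩ := exists_of_powerSumExpansion_ne_zero h0
  obtain ⟨x, y, hx, hy, hxy, -, rfl⟩ := hs.exists_eq_insert_pendantEdges hA
    (by rw [hAr]; exact hr.two_le_of_mem_componentSizes_insert hu hv huv)
    (by rw [hAr, hr.card_componentSizes_insert hu hv huv]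
        exact le_antisymm (hr.card_coreVerts_le hs h) (hs.card_coreVerts_le hr h.symm))
  have h1 := (hs.clusterSize_notMem_componentSizes_insert hx hy hxy hu').1 (by
    rw [hAr, huu']
    exact (hr.clusterSize_notMem_componentSizes_insert hu hv huv hu).2 (Or.inl rfl))
  have h2 := (hs.clusterSize_notMem_componentSizes_insert hx hy hxy hv').1 (by
    rw [hAr, hvv']
    exact (hr.clusterSize_notMem_componentSizes_insert hu hv huv hv).2 (Or.inr rfl))
  have hne : u' ≠ v' := by
    rintro rfl
    exact huv.ne (hr.inj u v hu hv (huu'.symm.trans hvv'))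
  rcases h1 with rfl | rfl <;> rcases h2 with rfl | rfl
  · exact absurd rfl hne
  · exact hxy
  · exact hxy.symm
  · exact absurd rfl hne

/-- A bijection between the cores that preserves the sizes of the clusters extends to a bijection
that commutes with the retractions. -/
theorem exists_equiv_comm (hr : G.IsDistinctLeafRetraction r) (hs : H.IsDistinctLeafRetraction s)
    (φ : {x // r x = x} ≃ {y // s y = y}) (hφ : ∀ u, clusterSize s (φ u) = clusterSize r u) :
    ∃ Φ : V ≃ W, (∀ u, Φ u.1 = φ u) ∧ ∀ x, s (Φ x) = Φ (r x) := by
  classical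
  let f : V → {y // s y = y} := fun x => φ ⟨r x, hr.idem x⟩
  let g : W → {y // s y = y} := fun y => ⟨s y, hs.idem y⟩
  have hfib : ∀ c, ∃ e : {a // f a = c} ≃ {b // g b = c},
      ∀ a : {a // f a = c}, (a : V) = (φ.symm c : V) → (e a : W) = c := by
    intro c
    have hcard : Fintype.card {a // f a = c} = Fintype.card {b // g b = c} := by
      rw [Fintype.card_subtype, Fintype.card_subtype]
      have := hφ (φ.symm c)
      rw [Equiv.apply_symm_apply] at this
      unfold clusterSize at this
      convert this.symm using 4 with x x
      · rw [← Equiv.eq_symm_apply, Subtype.ext_iff]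
      · rw [Subtype.ext_iff]
    let e := Fintype.equivOfCardEq hcard
    let a₀ : {a // f a = c} := ⟨φ.symm c, by
      rw [← Equiv.eq_symm_apply, Subtype.ext_iff]
      exact (φ.symm c).2⟩
    let b₀ : {b // g b = c} := ⟨c, Subtype.ext c.2⟩
    -- The swap corrects an arbitrary bijection of fibers so that core vertex goes to core vertex.
    refine ⟨e.trans (Equiv.swap (e a₀) b₀), fun a ha => ?_⟩
    have : a = a₀ := Subtype.ext ha
    rw [this, Equiv.trans_apply, Equiv.swap_apply_left]
  choose e he using hfib
  have hΦ : ∀ u : {x // r x = x}, Equiv.ofFiberEquiv e u.1 = φ u := by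
    intro u
    have hu : f u = φ u := congrArg φ (Subtype.ext u.2)
    have h1 : Equiv.ofFiberEquiv e u.1 = e (f u.1) ⟨u.1, rfl⟩ := rfl
    have h2 : φ.symm (f u.1) = u := by rw [hu, Equiv.symm_apply_apply]
    rw [h1, he (f u.1) ⟨u.1, rfl⟩ (congrArg Subtype.val h2).symm, hu]
  refine ⟨Equiv.ofFiberEquiv e, hΦ, fun x => ?_⟩
  have h1 := congrArg Subtype.val (Equiv.ofFiberEquiv_map e x)
  have h2 := hΦ ⟨r x, hr.idem x⟩
  exact h1.trans h2.symm

theorem nonempty_iso (hr : G.IsDistinctLeafRetraction r) (hs : H.IsDistinctLeafRetraction s)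
    (h : powerSumExpansion G = powerSumExpansion H) : Nonempty (G ≃g H) := by
  obtain ⟨φ, hφ⟩ := hr.exists_equiv_core hs h
  obtain ⟨Φ, hΦ, hcomm⟩ := hr.exists_equiv_comm hs φ hφ
  have hfix : ∀ x, s (Φ x) = Φ x ↔ r x = x := fun x => by rw [hcomm, Φ.injective.eq_iff]
  have hleaf : ∀ x y, r x ≠ x → (H.Adj (Φ x) (Φ y) ↔ G.Adj x y) := by
    intro x y hx
    rw [hr.adj_iff x y hx, hs.adj_iff _ _ (mt (hfix x).1 hx), hcomm, Φ.injective.eq_iff]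
  refine ⟨⟨Φ, fun {x y} => ?_⟩⟩
  by_cases hx : r x = x
  · by_cases hy : r y = y
    · have hbx : clusterSize s (Φ x) = clusterSize r x := by rw [hΦ ⟨x, hx⟩, hφ]
      have hby : clusterSize s (Φ y) = clusterSize r y := by rw [hΦ ⟨y, hy⟩, hφ]
      exact ⟨hs.adj_of_adj hr h.symm ((hfix x).2 hx) ((hfix y).2 hy) hx hy hbx.symm hby.symm,
        hr.adj_of_adj hs h hx hy ((hfix x).2 hx) ((hfix y).2 hy) hbx hby⟩
    · rw [H.adj_comm, G.adj_comm]
      exact hleaf y x hy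
  · exact hleaf x y hx

end IsDistinctLeafRetraction

end Reconstruction

/-! ### The leaf retraction of a crab. -/

section CrabRetraction

variable {V : Type*} [Fintype V] {G : SimpleGraph V} [DecidableRel G.Adj]

/-- A chord closes an arc of the cycle to a second cycle. Rotating the base point to `u` makes the
arc to `w` an initial segment. -/
theorem IsUnicyclic.toSubgraph_adj {V : Type*} {G : SimpleGraph V} (hG : G.IsUnicyclic) {a : V}
    {p : G.Walk a a} (hp : p.IsCycle) {u w : V} (hu : u ∈ p.support) (hw : w ∈ p.support)
    (huw : G.Adj u w) : p.toSubgraph.Adj u w := by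
  classical
  by_contra hne
  have hmem : ∀ e, e ∈ (p.rotate u hu).edges ↔ e ∈ p.edges := fun e =>
    (p.rotate_edges u hu).mem_iff
  have hw' : w ∈ (p.rotate u hu).support := (p.mem_support_rotate_iff u hu).2 hw
  set t := (p.rotate u hu).takeUntil w hw' with ht
  have hpath : t.IsPath := (hp.rotate hu).isPath_takeUntil hw'
  have hcyc : (Walk.cons huw t.reverse).IsCycle := by
    rw [Walk.cons_isCycle_iff, Walk.isPath_reverse_iff, Walk.edges_reverse, List.mem_reverse]
    refine ⟨hpath, fun h => hne ?_⟩
    have := (hmem _).1 ((p.rotate u hu).edges_takeUntil_subset_edges hw' h)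
    rwa [← Walk.mem_edges_toSubgraph, Subgraph.mem_edgeSet] at this
  have heq := hG.unique ⟨_, _, hcyc, rfl⟩ ⟨_, p, hp, rfl⟩
  apply hne
  rw [← heq]
  simp [Walk.toSubgraph]

theorem IsCrab.isLeaf_iff_notMem_support (hG : G.IsCrab) {a : V} {p : G.Walk a a}
    (hp : p.IsCycle) (v : V) : G.IsLeaf v ↔ v ∉ p.support := by
  classical
  constructor
  · intro hv hmem
    have h2 := hp.ncard_neighborSet_toSubgraph_eq_two hmem
    have hle : (p.toSubgraph.neighborSet v).ncard ≤ (G.neighborSet v).ncard :=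
      Set.ncard_le_ncard (p.toSubgraph.neighborSet_subset v) (Set.toFinite _)
    rw [Set.ncard_eq_toFinset_card' (G.neighborSet v)] at hle
    have hd : G.degree v = 1 := hv
    change _ ≤ G.degree v at hle
    omega
  · intro hv
    exact hG.isLeaf_of_notMem_cycle _ ⟨a, p, hp, rfl⟩ v (by rwa [Walk.mem_verts_toSubgraph])

theorem IsCrab.exists_isCycle (hG : G.IsCrab) : ∃ (a : V) (p : G.Walk a a), p.IsCycle := by
  obtain ⟨_, ⟨a, p, hp, -⟩, -⟩ := hG.unicyclic
  exact ⟨a, p, hp⟩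

/-- As the cycle has no chord, these neighbors are the two along the cycle. -/
theorem IsCrab.card_nonleaf_neighbors [DecidablePred G.IsLeaf] (hG : G.IsCrab) {u : V}
    (hu : ¬ G.IsLeaf u) : #{w ∈ G.neighborFinset u | ¬ G.IsLeaf w} = 2 := by
  obtain ⟨a, p, hp⟩ := hG.exists_isCycle
  have hiff := hG.isLeaf_iff_notMem_support hp
  have hu' : u ∈ p.support := not_not.1 (mt (hiff u).2 hu)
  rw [← hp.ncard_neighborSet_toSubgraph_eq_two hu', ← Set.ncard_coe_finset]
  congr 1
  ext w
  simp only [coe_filter, mem_neighborFinset, Set.mem_ofPred_eq, Subgraph.mem_neighborSet]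
  constructor
  · rintro ⟨h, hw⟩
    exact hG.unicyclic.toSubgraph_adj hp hu' (not_not.1 (mt (hiff w).2 hw)) h
  · intro h
    refine ⟨h.adj_sub, fun hw => (hiff w).1 hw ?_⟩
    rw [← Walk.mem_verts_toSubgraph]
    exact h.snd_mem

/-- Two adjacent leaves would form a whole component, leaving no path to the cycle. -/
theorem IsCrab.not_isLeaf_of_adj (hG : G.IsCrab) {x y : V} (hx : G.IsLeaf x)
    (hxy : G.Adj x y) : ¬ G.IsLeaf y := by
  intro hy
  obtain ⟨a, p, hp⟩ := hG.exists_isCycle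
  have ha : ¬ G.IsLeaf a := fun h => (hG.isLeaf_iff_notMem_support hp a).1 h p.start_mem_support
  have huniq : ∀ {v w w' : V}, G.IsLeaf v → G.Adj v w → G.Adj v w' → w = w' := fun hv h h' =>
    (degree_eq_one_iff_existsUnique_adj.1 hv).unique h h'
  have hw : ∀ (b c : V) (q : G.Walk b c), b = x ∨ b = y → c = x ∨ c = y := by
    intro b c q
    induction q with
    | nil => exact id
    | cons h _ ih =>
      rintro (rfl | rfl)
      · exact ih (Or.inr (huniq hx h hxy))
      · exact ih (Or.inl (huniq hy h hxy.symm))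
  obtain ⟨q⟩ := hG.connected.preconnected x a
  rcases hw _ _ q (Or.inl rfl) with rfl | rfl
  · exact ha hx
  · exact ha hy

theorem IsCrab.exists_isDistinctLeafRetraction (hG : G.IsCrab)
    (hdist : ∀ u v : V, ¬ G.IsLeaf u → ¬ G.IsLeaf v → u ≠ v → G.degree u ≠ G.degree v)
    (hdeg : ∀ v : V, ¬ G.IsLeaf v → 2 < G.degree v) :
    ∃ r : V → V, G.IsDistinctLeafRetraction r := by
  classical
  have hex : ∀ x, ∃ y, (G.IsLeaf x → ∀ z, G.Adj x z ↔ z = y) ∧ (¬ G.IsLeaf x → y = x) := by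
    intro x
    by_cases hx : G.IsLeaf x
    · obtain ⟨y, hy, huniq⟩ := degree_eq_one_iff_existsUnique_adj.1 hx
      exact ⟨y, fun _ z => ⟨huniq z, fun h => h ▸ hy⟩, fun h => absurd hx h⟩
    · exact ⟨x, fun h => absurd h hx, fun _ => rfl⟩
  choose r hr hr' using hex
  have hadj : ∀ x, G.IsLeaf x → G.Adj x (r x) := fun x hx => (hr x hx _).2 rfl
  have hfix : ∀ x, r x = x ↔ ¬ G.IsLeaf x :=
    fun x => ⟨fun h hx => (hadj x hx).ne h.symm, hr' x⟩
  -- A cluster consists of `u` and its leaves, while the degree counts the leaves and two cycle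
  -- neighbors. Hence degree greater than 2 means cluster size at least 2.
  have hcluster : ∀ u, r u = u → clusterSize r u + 1 = G.degree u := by
    intro u hu
    have hu' := (hfix u).1 hu
    have h1 := card_filter_add_card_filter_not (s := G.neighborFinset u) fun w => G.IsLeaf w
    rw [hG.card_nonleaf_neighbors hu', card_neighborFinset_eq_degree] at h1
    have h2 : ({x | r x = u} : Finset V) = insert u {w ∈ G.neighborFinset u | G.IsLeaf w} := by
      ext x
      simp only [mem_filter, mem_univ, true_and, mem_insert, mem_neighborFinset]
      by_cases hx : G.IsLeaf x
      · have hxu : x ≠ u := fun h => hu' (h ▸ hx)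
        rw [G.adj_comm, hr x hx]
        simp [hx, hxu, eq_comm]
      · simp [hx, hr' x hx]
    have h3 : clusterSize r u = #({x | r x = u} : Finset V) := by
      unfold clusterSize
      congr!
    rw [h3, h2, card_insert_of_notMem (by simp)]
    omega
  refine ⟨r, ⟨⟨fun x => ?_, fun x y hx => ?_⟩, fun u hu => ?_, fun u v hu hv h => ?_⟩⟩
  · by_cases hx : G.IsLeaf x
    · exact hr' _ (hG.not_isLeaf_of_adj hx (hadj x hx))
    · rw [hr' x hx, hr' x hx]
  · exact hr x (not_not.1 (mt (hfix x).2 hx)) y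
  · have := hcluster u hu
    have := hdeg u ((hfix u).1 hu)
    omega
  · by_contra hne
    refine hdist u v ((hfix u).1 hu) ((hfix v).1 hv) hne ?_
    rw [← hcluster u hu, ← hcluster v hv, h]

end CrabRetraction

end SimpleGraph

theorem mainTheorem7 {V : Type*} {W : Type*} [Fintype V] [Fintype W]
    (G : SimpleGraph V) (H : SimpleGraph W) [DecidableRel G.Adj] [DecidableRel H.Adj]
    (hG : G.IsCrab) (hH : H.IsCrab)
    (hGdist : ∀ u v : V, ¬ G.IsLeaf u → ¬ G.IsLeaf v → u ≠ v → G.degree u ≠ G.degree v)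
    (hGdeg : ∀ v : V, ¬ G.IsLeaf v → 2 < G.degree v)
    (hHdist : ∀ u v : W, ¬ H.IsLeaf u → ¬ H.IsLeaf v → u ≠ v → H.degree u ≠ H.degree v)
    (hHdeg : ∀ v : W, ¬ H.IsLeaf v → 2 < H.degree v)
    (hX : G.chromaticSymmetricFunction = H.chromaticSymmetricFunction) :
    Nonempty (G ≃g H) := by
  obtain ⟨r, hr⟩ := hG.exists_isDistinctLeafRetraction hGdist hGdeg
  obtain ⟨s, hs⟩ := hH.exists_isDistinctLeafRetraction hHdist hHdeg
  exact hr.nonempty_iso hs (SimpleGraph.powerSumExpansion_eq hX)
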